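/- Let $\mathrm{Loc}$ be the category of locales (posets with finite infima and arbitrary suprema in which binary infima distribute over arbitrary suprema; a morphism $Y\to X$ is a map of posets $g^*\colon X\to Y$ preserving finite infima and arbitrary suprema). An open cover of a locale $X$ is a family $\{U_i\}_{i\in I}$ of opens of $X$, indexed by a set, with $\bigvee_i U_i=X$; it is identified with the family of open inclusions $\{U_i\to X\}_{i\in I}$ in $\mathrm{Loc}$. An open cover is disjoint if $U_i\wedge U_j=\bot$ for all $i\ne j$. It is numerable if there is a family of continuous maps $f_i\colon X\to[0,\infty)$ such that the sum $\sum_{i\in I}f_i$ is everywhere defined and is a continuous map $X\to(0,\infty)$, and $f_i^*(0,\infty)\le U_i$ for all $i\in I$. Here a continuous map from $X$ to a space $T$ is a morphism from $X$ to the locale of open subsets of $T$, and $\sum_i f_i$ is everywhere defined and equal to a continuous map $s\colon X\to[0,\infty)$ if for all real $q\ge0$ $$s^*(q,\infty)=\bigvee\Bigl\{\bigwedge_{i\in F}f_i^*(r_i,\infty)\Bigm| F\subset I\text{ finite},\ r_i\ge 0\ (i\in F),\ \sum_{i\in F}r_i>q\Bigr\}.$$ The Grothendieck topology generated by a collection of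 families of morphisms is the smallest Grothendieck topology for which the sieve generated by each of these families is a covering sieve. Numerable open covers are stable under inverse images, so they form a coverage on $\mathrm{Loc}$; the Grothendieck topology of numerable open covers is the one generated by this coverage. Theorem. The Grothendieck topology of numerable open covers on $\mathrm{Loc}$ is generated by the disjoint open covers (indexed by arbitrary sets) together with the numerable open covers with two elements. -/

import Mathlib

open CategoryTheory TopologicalSpace
open scoped NNReal

universe u v w

namespace LocaleNumerable

section Partitions

/-- The open ray `(q, ∞)` in `[0, ∞)`. -/
def ray (q : ℝ≥0) : Opens ℝ≥0 := ⟨Set.Ioi q, isOpen_Ioi⟩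

/-- A continuous map from the locale whose frame of opens is `X` to the space `[0, ∞)`
(regarded as a locale), given by its inverse image map `Opens [0, ∞) → X`. -/
abbrev NonnegMap (X : Type u) [Order.Frame X] : Type u := FrameHom (Opens ℝ≥0) X

variable {X : Type u} [Order.Frame X] {I : Type v}

/-- The open part of the locale on which `∑ i, f i > q`. As for functions on a space, a sum of
nonnegative functions exceeds `q` exactly where there are a finite set `F` of indices and constants
`r i` for `i ∈ F` with `∑ i ∈ F, r i > q` and `f i > r i` for all `i ∈ F`. -/
def sumGT (f : I → NonnegMap X) (q : ℝ≥0) : X :=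
  ⨆ (F : Finset I) (r : I → ℝ≥0) (_ : q < ∑ i ∈ F, r i), ⨅ i ∈ F, f i (ray (r i))

/-- The sum `∑ i, f i` is everywhere defined and equal to the continuous map `s`
(a continuous map to `[0, ∞)` is determined by the inverse images of the rays `(q, ∞)`). -/
def IsSum (f : I → NonnegMap X) (s : NonnegMap X) : Prop :=
  ∀ q : ℝ≥0, s (ray q) = sumGT f q

/-- A positive partition on a locale: a family of continuous maps to `[0, ∞)` whose sum is
everywhere defined, continuous and strictly positive. -/
def IsPositivePartition (f : I → NonnegMap X) : Prop :=
  ∃ s : NonnegMap X, IsSum f s ∧ s (ray 0) = ⊤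

/-- A family of opens that covers the locale. -/
def IsOpenCover (U : I → X) : Prop := ⨆ i, U i = ⊤

/-- A numerable open cover: an open cover `U` that admits a compatible positive partition `f`,
i.e. the inverse image of `(0, ∞)` under `f i` is contained in `U i`. -/
def IsNumerable (U : I → X) : Prop :=
  IsOpenCover U ∧ ∃ f : I → NonnegMap X, IsPositivePartition f ∧ ∀ i, f i (ray 0) ≤ U i

/-- A disjoint open cover: an open cover with pairwise disjoint elements. -/
def IsDisjointCover (U : I → X) : Prop :=
  IsOpenCover U ∧ Pairwise fun i j => Disjoint (U i) (U j)

/-- Numerable open covers are stable under inverse images. -/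
theorem IsNumerable.map {Y : Type w} [Order.Frame Y] {U : I → X} (h : IsNumerable U)
    (g : FrameHom X Y) : IsNumerable fun i => g (U i) := by
  have hfin : ∀ (F : Finset I) (t : I → X), g (⨅ i ∈ F, t i) = ⨅ i ∈ F, g (t i) := by
    intro F t
    rw [← Finset.inf_eq_iInf, ← Finset.inf_eq_iInf, map_finset_inf]
    rfl
  obtain ⟨hU, f, ⟨s, hs, hpos⟩, hf⟩ := h
  refine ⟨?_, fun i => g.comp (f i), ⟨g.comp s, fun q => ?_, ?_⟩, fun i => ?_⟩
  · unfold IsOpenCover at hU ⊢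
    rw [← map_iSup, hU, map_top]
  · simp only [FrameHom.comp_apply, hs q, sumGT, map_iSup, hfin]
  · simp [hpos]
  · exact OrderHomClass.mono g (hf i)

end Partitions

section OpenSublocales

/-- The opens contained in a fixed open `U` form a frame. -/
instance frameIic {X : Type u} [Order.Frame X] (U : X) : Order.Frame (Set.Iic U) :=
  .ofMinimalAxioms
    { inf_sSup_le_iSup_inf := fun a s => by
        rw [← Subtype.coe_le_coe]
        simp [sSup_image, inf_iSup_eq] }

/-- The frame homomorphism `V ↦ V ⊓ U` from the opens of `X` to the opens contained in `U`. -/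
def restrictHom {X : Type u} [Order.Frame X] (U : X) : FrameHom X (Set.Iic U) where
  toFun V := ⟨V ⊓ U, inf_le_right⟩
  map_inf' V W := Subtype.ext (inf_inf_distrib_right V W U)
  map_top' := Subtype.ext (top_inf_eq U)
  map_sSup' s := by
    apply Subtype.ext
    simp [sSup_inf_eq, sSup_image]

/-- The open sublocale of `X` given by an open `U`. -/
def openSublocale (X : Locale.{u}) (U : X) : Locale.{u} := Locale.of (Set.Iic U)

/-- The open inclusion `U → X`; its inverse image map is `V ↦ V ⊓ U`. -/
def openInclusion (X : Locale.{u}) (U : X) : openSublocale X U ⟶ X :=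
  Quiver.Hom.op (Frm.ofHom (restrictHom (X := X) U))

/-- The family of open inclusions `U i → X` given by a family of opens of `X`. -/
def openFamily (X : Locale.{u}) {I : Type v} (U : I → X) : Presieve X :=
  Presieve.ofArrows (fun i => openSublocale X (U i)) (fun i => openInclusion X (U i))

/-- The inverse image map of a morphism of locales. -/
def inverseImage {X Y : Locale.{u}} (g : Y ⟶ X) : FrameHom X Y :=
  Frm.Hom.hom (Quiver.Hom.unop g)

/-- A morphism `g : Y → X` restricts to a morphism from the inverse image of `U` to `U`. -/
def restrictInverseImage {X Y : Locale.{u}} (g : Y ⟶ X) (U : X) :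
    openSublocale Y (inverseImage g U) ⟶ openSublocale X U :=
  Quiver.Hom.op (Frm.ofHom (X := Set.Iic U) (Y := Set.Iic (inverseImage g U))
    { toFun := fun V => ⟨inverseImage g V, OrderHomClass.mono (inverseImage g) V.2⟩
      map_inf' := fun V W => Subtype.ext (map_inf (inverseImage g) V.1 W.1)
      map_top' := rfl
      map_sSup' := fun s => by
        apply Subtype.ext
        simp [sSup_image] })

theorem restrictInverseImage_comp {X Y : Locale.{u}} (g : Y ⟶ X) (U : X) :
    restrictInverseImage g U ≫ openInclusion X U = openInclusion Y (inverseImage g U) ≫ g := by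
  apply Quiver.Hom.unop_inj
  apply Frm.ext
  intro V
  exact Subtype.ext (map_inf (inverseImage g) V U)

end OpenSublocales

section Topologies

/-- The coverage of numerable open covers on the category of locales. -/
def numerableCoverage : Coverage Locale.{u} where
  coverings X := {R | ∃ (I : Type u) (U : I → X), IsNumerable U ∧ R = openFamily X U}
  pullback := by
    rintro X Y g _ ⟨I, U, hU, rfl⟩
    refine ⟨_, ⟨I, fun i => inverseImage g (U i), hU.map _, rfl⟩, ?_⟩
    rintro _ _ ⟨i⟩
    exact ⟨_, restrictInverseImage g (U i), _, ⟨i⟩, restrictInverseImage_comp g (U i)⟩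

/-- The disjoint open covers of locales, indexed by arbitrary sets. -/
def disjointCovers : Precoverage Locale.{u} where
  coverings X := {R | ∃ (I : Type u) (U : I → X), IsDisjointCover U ∧ R = openFamily X U}

/-- The numerable open covers of locales with two elements. -/
def twoElementNumerableCovers : Precoverage Locale.{u} where
  coverings X := {R | ∃ U : Fin 2 → X, IsNumerable U ∧ R = openFamily X U}

end Topologies

end LocaleNumerable

namespace LocaleNumerable

/-! ### Numerable covers of topological spaces. -/

section SpatialSums

/-! Disjoint covers are numerable because they are pulled back from the singletons of a discrete
space. For the converse, a positive partition `f` with sum `s` is a localic point-free version of a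
map into the cone of nonnegative ℓ¹ families: `IsSum.hom` pulls `posAt i` back into the open where
`f i` is positive, and pulls `pos I` back to `⊤`. It therefore suffices to cover `pos I` by the
`posAt i` inside this one metric space.

There, `pos I` is the union of the opens `dominant F` over nonempty finite `F`. Each lies in some
`posAt i`, and those with equal cardinality are disjoint, so only a countable union remains.
`iSup_nat_of_metric` cuts it into shells, the even ones disjoint and the odd ones disjoint; a binary
union of opens is numerable because metric spaces are normal.

As `X` may lack points, the hard step is that `IsSum.hom` preserves joins. In `boxOpen_le`, a box
violating the required inequality is refined repeatedly to shrinking boxes that also violate it, and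
completeness of the cone gives a common point that contradicts the local hypothesis. -/

theorem mem_iInf_finset_opens {Y : Type u} [TopologicalSpace Y] {I : Type v} (F : Finset I)
    (U : I → Opens Y) (x : Y) : x ∈ ⨅ i ∈ F, U i ↔ ∀ i ∈ F, x ∈ U i := by
  rw [← Finset.inf_eq_iInf, ← SetLike.mem_coe, Opens.coe_finset_inf]
  simp [Finset.inf_eq_iInf]

theorem mem_sumGT_comap {Y : Type u} [TopologicalSpace Y] {I : Type v} (f : I → C(Y, ℝ≥0))
    (q : ℝ≥0) (x : Y) : x ∈ sumGT (fun i => Opens.comap (f i)) q ↔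
      ∃ (F : Finset I) (r : I → ℝ≥0), q < ∑ i ∈ F, r i ∧ ∀ i ∈ F, r i < f i x := by
  simp only [sumGT, Opens.mem_iSup, mem_iInf_finset_opens, Opens.mem_comap, exists_prop]
  rfl

/-- A pointwise sum of continuous functions on a space is a sum in the localic sense. -/
theorem isSum_comap {Y : Type u} [TopologicalSpace Y] {I : Type v} (f : I → C(Y, ℝ≥0))
    (s : C(Y, ℝ≥0)) (h : ∀ x, HasSum (fun i => f i x) (s x)) :
    IsSum (fun i => Opens.comap (f i)) (Opens.comap s) := by
  intro q
  ext x
  rw [SetLike.mem_coe, SetLike.mem_coe, mem_sumGT_comap, Opens.mem_comap]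
  change q < s x ↔ _
  constructor
  · intro hq
    obtain ⟨F, hF⟩ := ((h x).eventually (lt_mem_nhds hq)).exists
    have hpos : 0 < ∑ i ∈ F, f i x := zero_le.trans_lt hF
    -- Scaling by `t < 1` makes the lower bounds strict while the finite sum still exceeds `q`;
    -- indices with value zero are dropped, as no strict bound exists there.
    obtain ⟨t, ht, ht1⟩ := exists_between ((div_lt_one hpos).2 hF)
    refine ⟨F.filter fun i => 0 < f i x, fun i => t * f i x, ?_, fun i hi => ?_⟩
    · rw [← Finset.mul_sum]
      rw [div_lt_iff₀ hpos] at ht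
      refine ht.trans_eq ?_
      congr 1
      symm
      refine Finset.sum_filter_of_ne fun i _ hi => pos_iff_ne_zero.2 hi
    · exact mul_lt_of_lt_one_left (Finset.mem_filter.1 hi).2 ht1
  · rintro ⟨F, r, hq, hr⟩
    exact hq.trans_le ((Finset.sum_le_sum fun i hi => (hr i hi).le).trans
      (sum_le_hasSum F (fun _ _ => zero_le) (h x)))

theorem isNumerable_of_hasSum {Y : Type u} [TopologicalSpace Y] {I : Type v} {U : I → Opens Y}
    (f : I → C(Y, ℝ≥0)) (s : C(Y, ℝ≥0)) (h : ∀ x, HasSum (fun i => f i x) (s x))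
    (hs : ∀ x, 0 < s x) (hf : ∀ i x, 0 < f i x → x ∈ U i) : IsNumerable U := by
  refine ⟨?_, _, ⟨_, isSum_comap f s h, ?_⟩, fun i x hx => hf i x hx⟩
  · refine top_unique fun x _ => ?_
    by_contra hx
    rw [Opens.mem_iSup, not_exists] at hx
    have h0 : ∀ i, f i x = 0 := fun i => by
      by_contra hi
      exact hx i (hf i x (pos_iff_ne_zero.2 hi))
    have := h x
    simp only [h0] at this
    exact (hs x).ne' (this.unique hasSum_zero)
  · exact top_unique fun x _ => hs x

/-- Every open cover of a normal space with two elements is numerable. -/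
theorem isNumerable_pair {Y : Type u} [TopologicalSpace Y] [NormalSpace Y] {U V : Opens Y}
    (h : U ⊔ V = ⊤) : IsNumerable ![U, V] := by
  have hd : Disjoint ((U : Set Y)ᶜ) ((V : Set Y)ᶜ) := by
    rw [Set.disjoint_compl_left_iff_subset, Set.compl_subset_iff_union, Set.union_comm]
    simpa using congrArg (fun W : Opens Y => (W : Set Y)) h
  obtain ⟨f, hf0, hf1, hf⟩ := exists_continuous_zero_one_of_isClosed U.isOpen.isClosed_compl
    V.isOpen.isClosed_compl hd
  refine isNumerable_of_hasSum
    ![⟨fun x => (f x).toNNReal, by fun_prop⟩, ⟨fun x => (1 - f x).toNNReal, by fun_prop⟩]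
    (ContinuousMap.const Y 1) (fun x => ?_) (fun _ => one_pos) ?_
  · convert hasSum_fintype _ using 1
    rw [Fin.sum_univ_two]
    change 1 = (f x).toNNReal + (1 - f x).toNNReal
    rw [← Real.toNNReal_add (hf x).1 (sub_nonneg.2 (hf x).2)]
    simp
  · rw [Fin.forall_fin_two]
    refine ⟨fun x hx => ?_, fun x hx => ?_⟩
    · by_contra hxU
      have h0 : f x = 0 := hf0 hxU
      change 0 < (f x).toNNReal at hx
      simp [h0] at hx
    · by_contra hxV
      have h1 : f x = 1 := hf1 hxV
      change 0 < (1 - f x).toNNReal at hx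
      simp [h1] at hx

end SpatialSums

/-! ### Disjoint covers are numerable. -/

section DisjointCovers

/-- A disjoint open cover of a locale is a morphism to a discrete space. -/
def indexHom {X : Type u} [Order.Frame X] {I : Type v} [TopologicalSpace I]
    {U : I → X} (hU : IsDisjointCover U) : FrameHom (Opens I) X where
  toFun S := ⨆ i ∈ S, U i
  map_top' := by simpa using show ⨆ i, U i = ⊤ from hU.1
  map_inf' S T := by
    apply le_antisymm
    · exact iSup₂_le fun i hi => le_inf (le_iSup₂_of_le i hi.1 le_rfl)
        (le_iSup₂_of_le i hi.2 le_rfl)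
    · rw [iSup₂_inf_eq]
      refine iSup₂_le fun i hi => ?_
      rw [inf_iSup₂_eq]
      refine iSup₂_le fun j hj => ?_
      by_cases hij : i = j
      · subst hij
        exact inf_le_left.trans (le_iSup₂_of_le i ⟨hi, hj⟩ le_rfl)
      · exact (hU.2 hij).le_bot.trans bot_le
  map_sSup' S := by
    apply le_antisymm
    · refine iSup₂_le fun i hi => ?_
      obtain ⟨T, hT, hi⟩ := Opens.mem_sSup.1 hi
      exact le_sSup_of_le ⟨T, hT, rfl⟩ (le_iSup₂_of_le i hi le_rfl)
    · refine sSup_le ?_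
      rintro _ ⟨T, hT, rfl⟩
      exact iSup₂_le fun i hi => le_iSup₂_of_le i (Opens.mem_sSup.2 ⟨T, hT, hi⟩) le_rfl

theorem isNumerable_singletons (I : Type v) [TopologicalSpace I] [DiscreteTopology I] :
    IsNumerable fun i : I => (⟨{i}, isOpen_discrete _⟩ : Opens I) := by
  classical
  refine isNumerable_of_hasSum (fun i => ⟨fun j => if i = j then 1 else 0,
    continuous_of_discreteTopology⟩) (ContinuousMap.const I 1) (fun j => ?_) (fun _ => one_pos) ?_
  · exact hasSum_ite_eq j 1
  · intro i j hij
    by_contra hne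
    have : i ≠ j := fun h => hne h.symm
    simp [this] at hij

theorem IsDisjointCover.isNumerable {X : Type u} [Order.Frame X] {I : Type v} {U : I → X}
    (hU : IsDisjointCover U) : IsNumerable U := by
  let : TopologicalSpace I := ⊥
  have : DiscreteTopology I := ⟨rfl⟩
  have := (isNumerable_singletons I).map (indexHom hU)
  have h : ∀ i, indexHom hU (⟨{i}, isOpen_discrete _⟩ : Opens I) = U i := fun i => by
    change ⨆ j ∈ ({i} : Set I), U j = U i
    simp
  simpa only [h] using this

end DisjointCovers

/-! ### Change of index set. -/

section Reindexing

theorem iInf_finset_map {X : Type u} [CompleteLattice X] {I : Type v} {J : Type w} (e : J ≃ I)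
    (F : Finset J) (g : I → X) : ⨅ i ∈ F.map e.toEmbedding, g i = ⨅ j ∈ F, g (e j) := by
  rw [← e.iInf_comp]
  simp

theorem IsNumerable.reindex {X : Type u} [Order.Frame X] {I : Type v} {J : Type w} {U : I → X}
    (hU : IsNumerable U) (e : J ≃ I) : IsNumerable (U ∘ e) := by
  obtain ⟨hc, f, ⟨s, hs, hpos⟩, hf⟩ := hU
  refine ⟨?_, f ∘ e, ⟨s, fun q => ?_, hpos⟩, fun j => hf (e j)⟩
  · exact (e.surjective.iSup_comp U).trans hc
  · rw [hs q]
    apply le_antisymm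
    · refine iSup_le fun F => iSup_le fun r => iSup_le fun hr => ?_
      refine le_iSup_of_le (F.map e.symm.toEmbedding) (le_iSup_of_le (r ∘ e)
        (le_iSup_of_le ?_ ?_))
      · simpa using hr
      · rw [iInf_finset_map]
        simp
    · refine iSup_le fun F => iSup_le fun r => iSup_le fun hr => ?_
      refine le_iSup_of_le (F.map e.toEmbedding) (le_iSup_of_le (r ∘ e.symm)
        (le_iSup_of_le ?_ ?_))
      · simpa using hr
      · rw [iInf_finset_map]
        simp

end Reindexing

/-! ### Sieves that cover over an open. -/

section LocalCovering

variable {X : Locale.{u}}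

theorem inverseImage_comp {X Y Z : Locale.{u}} (g : Y ⟶ X) (h : Z ⟶ Y) (V : X) :
    inverseImage (h ≫ g) V = inverseImage h (inverseImage g V) := rfl

theorem inverseImage_openInclusion_self (X : Locale.{u}) (V : X) :
    inverseImage (openInclusion X V) V = ⊤ :=
  Subtype.ext (inf_idem V)

/-- A morphism for which the inverse image of `V` is everything factors through `V`. -/
theorem exists_comp_openInclusion_eq {Y : Locale.{u}} (g : Y ⟶ X) (V : X)
    (h : inverseImage g V = ⊤) : ∃ k : Y ⟶ openSublocale X V, k ≫ openInclusion X V = g := by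
  refine ⟨Quiver.Hom.op (Frm.ofHom (X := Set.Iic V) (Y := Y)
    { toFun := fun W => inverseImage g W.1
      map_inf' := fun W W' => map_inf (inverseImage g) W.1 W'.1
      map_top' := h
      map_sSup' := fun s => by simp [sSup_image, map_iSup] }), ?_⟩
  apply Quiver.Hom.unop_inj
  apply Frm.ext
  intro W
  change inverseImage g (W ⊓ V) = inverseImage g W
  rw [map_inf, h, inf_top_eq]

theorem generate_openFamily_iff {I : Type v} (U : I → X) {Y : Locale.{u}} (g : Y ⟶ X) :
    Sieve.generate (openFamily X U) g ↔ ∃ i, inverseImage g (U i) = ⊤ := by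
  constructor
  · rintro ⟨_, k, _, ⟨i⟩, rfl⟩
    exact ⟨i, by rw [inverseImage_comp, inverseImage_openInclusion_self, map_top]⟩
  · rintro ⟨i, hi⟩
    obtain ⟨k, rfl⟩ := exists_comp_openInclusion_eq g (U i) hi
    exact ⟨_, k, _, ⟨i⟩, rfl⟩

/-- A sieve is covering over an open `V` if its pullback along every morphism into `V` is
covering. -/
def CoversOver (J : GrothendieckTopology Locale.{u}) (S : Sieve X) (V : X) : Prop :=
  ∀ ⦃Y : Locale.{u}⦄ (g : Y ⟶ X), inverseImage g V = ⊤ → S.pullback g ∈ J Y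

variable {J : GrothendieckTopology Locale.{u}} {S : Sieve X}

theorem CoversOver.mono {V W : X} (hW : CoversOver J S W) (h : V ≤ W) : CoversOver J S V :=
  fun _ g hg => hW g (top_unique (hg.ge.trans (OrderHomClass.mono (inverseImage g) h)))

theorem coversOver_generate_openFamily {I : Type v} (U : I → X) (i : I) :
    CoversOver J (Sieve.generate (openFamily X U)) (U i) := fun Y g hg => by
  rw [Sieve.mem_iff_pullback_eq_top g |>.1 ((generate_openFamily_iff U g).2 ⟨i, hg⟩)]
  exact J.top_mem Y

/-- This is the transitivity axiom, applied on the open sublocale of the union and then pulled back.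
-/
theorem coversOver_iSup {I : Type v} {U : I → X}
    (h : Sieve.generate (openFamily (openSublocale X (⨆ i, U i))
      fun i => inverseImage (openInclusion X (⨆ i, U i)) (U i)) ∈ J _)
    (hU : ∀ i, CoversOver J S (U i)) : CoversOver J S (⨆ i, U i) := by
  intro Y g hg
  obtain ⟨k, rfl⟩ := exists_comp_openInclusion_eq g _ hg
  rw [Sieve.pullback_comp]
  refine J.pullback_stable k (J.transitive h _ fun Z m hm => ?_)
  obtain ⟨i, hi⟩ := (generate_openFamily_iff _ m).1 hm
  rw [← Sieve.pullback_comp]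
  exact hU i _ hi

theorem coversOver_iSup_of_disjoint
    (hJ : ∀ (Y : Locale.{u}) (I : Type u) (U : I → Y), IsDisjointCover U →
      Sieve.generate (openFamily Y U) ∈ J Y)
    {I : Type u} {U : I → X} (hd : Pairwise fun i j => Disjoint (U i) (U j))
    (hU : ∀ i, CoversOver J S (U i)) : CoversOver J S (⨆ i, U i) := by
  refine coversOver_iSup (hJ _ _ _ ⟨?_, fun i j hij => ?_⟩) hU
  · unfold IsOpenCover
    rw [← map_iSup, inverseImage_openInclusion_self]
  · change Disjoint (inverseImage _ (U i)) (inverseImage _ (U j))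
    rw [disjoint_iff, ← map_inf, (hd hij).eq_bot, map_bot]

end LocalCovering

/-! ### Binary unions in metric spaces. -/

section OpenSubspaces

/-- The opens of an open subspace are the opens contained in it. -/
def opensSubtypeHom {T : Type u} [TopologicalSpace T] (W : Opens T) :
    FrameHom (Opens W) (Set.Iic W) where
  toFun O := ⟨⟨Subtype.val '' (O : Set W), W.isOpen.isOpenMap_subtype_val _ O.isOpen⟩, by
    rintro _ ⟨x, -, rfl⟩
    exact x.2⟩
  map_inf' O O' := Subtype.ext (Opens.ext (Set.image_inter Subtype.val_injective))
  map_top' := Subtype.ext (Opens.ext (by simp))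
  map_sSup' s := Subtype.ext (Opens.ext (by simp [sSup_image, Set.image_iUnion]))

/-- The subspace `W` is again metric, hence normal; normality of `T` alone would not pass to open
subspaces. -/
theorem isNumerable_restrict_pair {T : Type u} [MetricSpace T] (U V W : Opens T)
    (hW : W = U ⊔ V) : IsNumerable fun i => restrictHom W (![U, V] i) := by
  have hO : ∀ O : Opens T, opensSubtypeHom W (Opens.comap ⟨Subtype.val, by fun_prop⟩ O) =
      restrictHom W O := fun O => Subtype.ext (Opens.ext (by
    change Subtype.val '' (Subtype.val ⁻¹' (O : Set T)) = (O : Set T) ∩ (W : Set T)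
    rw [Set.image_preimage_eq_inter_range, Subtype.range_coe]))
  have h := (isNumerable_pair (Y := W) (U := Opens.comap ⟨Subtype.val, by fun_prop⟩ U)
    (V := Opens.comap ⟨Subtype.val, by fun_prop⟩ V) (by
      rw [← map_sup, ← hW]; ext x; simp)).map (opensSubtypeHom W)
  convert h using 2 with i
  fin_cases i
  · exact (hO U).symm
  · exact (hO V).symm

theorem coversOver_sup {T : Type u} [MetricSpace T] {J : GrothendieckTopology Locale.{u}}
    {S : Sieve (Locale.of (Opens T))}
    (hJ : ∀ (Y : Locale.{u}) (U : Fin 2 → Y), IsNumerable U →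
      Sieve.generate (openFamily Y U) ∈ J Y)
    {U V : Opens T} (hU : CoversOver J S U) (hV : CoversOver J S V) :
    CoversOver J S (U ⊔ V : Opens T) := by
  have h : (U ⊔ V : Opens T) = ⨆ i, ![U, V] i :=
    le_antisymm (sup_le (le_iSup ![U, V] 0) (le_iSup ![U, V] 1))
      (iSup_le (Fin.forall_fin_two.2 ⟨le_sup_left, le_sup_right⟩))
  have key := coversOver_iSup (X := Locale.of (Opens T)) (J := J) (S := S) (U := ![U, V])
    (hJ _ _ (isNumerable_restrict_pair U V _ h.symm)) (Fin.forall_fin_two.2 ⟨hU, hV⟩)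
  exact key.mono h.le

end OpenSubspaces

/-! ### Countable unions in metric spaces. -/

section MetricSpaces

variable {T : Type u} [MetricSpace T]

/-- After replacing `W` by its partial unions, the functions `e n`, `n` times the distance to the
complement, increase and eventually exceed 1 at each point of the union. The shells `P n` record
where 1 is crossed, and shells two or more steps apart are disjoint. -/
theorem iSup_nat_of_metric {G : Opens T → Prop} (mono : ∀ {U V}, G V → U ≤ V → G U)
    (disj : ∀ {I : Type u} {U : I → Opens T}, (Pairwise fun i j => Disjoint (U i) (U j)) →
      (∀ i, G (U i)) → G (⨆ i, U i))
    (sup : ∀ {U V}, G U → G V → G (U ⊔ V)) {W : ℕ → Opens T} (hW : ∀ n, G (W n)) :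
    G (⨆ n, W n) := by
  have hW' : ∀ n, G (partialSups W n) := fun n => by
    induction n with
    | zero => simpa using hW 0
    | succ n ih => rw [partialSups_add_one]; exact sup ih (hW _)
  let d : ℕ → T → ENNReal := fun n x => Metric.infEDist x (partialSups W n : Set T)ᶜ
  let e : ℕ → T → ENNReal := fun n x => n * d n x
  have hd : ∀ {n m}, n ≤ m → ∀ x, d n x ≤ d m x := fun h x =>
    Metric.infEDist_anti (Set.compl_subset_compl.2 ((partialSups W).mono h))
  have he : ∀ {n m}, n ≤ m → ∀ x, e n x ≤ e m x := fun h x =>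
    mul_le_mul' (by exact_mod_cast h) (hd h x)
  -- The growing factor `n` makes the crossing strict: one more copy of a positive distance is
  -- added.
  have hstep : ∀ n x, 1 ≤ e n x → 1 < e (n + 1) x := fun n x h => by
    have h0 : d n x ≠ 0 := fun h0 => by simp [e, h0] at h
    calc (1 : ENNReal) < 1 + d n x := ENNReal.lt_add_right ENNReal.one_ne_top h0
      _ ≤ e n x + d n x := by gcongr
      _ = (n + 1 : ℕ) * d n x := by push_cast; ring
      _ ≤ e (n + 1) x := mul_le_mul_right (hd n.le_succ x) _
  have hcont : ∀ n, Continuous (e n) := fun n =>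
    (ENNReal.continuous_const_mul (ENNReal.natCast_ne_top n)).comp Metric.continuous_infEDist
  let P : ℕ → Opens T := fun n =>
    ⟨{x | 1 < e (n + 1) x ∧ e (n - 1) x < 1},
      (isOpen_lt continuous_const (hcont _)).inter (isOpen_lt (hcont _) continuous_const)⟩
  have hPW : ∀ n, P n ≤ partialSups W (n + 1) := fun n x hx => by
    by_contra hxW
    have h0 : d (n + 1) x = 0 := Metric.infEDist_zero_of_mem hxW
    have : 1 < e (n + 1) x := hx.1
    simp [e, h0] at this
  have hPd : ∀ {n m}, n + 2 ≤ m → Disjoint (P n) (P m) := fun {n m} h => by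
    rw [← Opens.coe_disjoint]
    refine Set.disjoint_left.2 fun x hn hm => ?_
    exact (hn.1.trans_le (he (by omega) x)).not_gt hm.2
  have hparity : ∀ c, G (⨆ k : ULift.{u} ℕ, P (2 * k.down + c)) := fun c => by
    refine disj (fun k l hkl => ?_) fun k => mono (hW' _) (hPW _)
    have hne : k.down ≠ l.down := fun h => hkl (ULift.ext _ _ h)
    rcases lt_or_gt_of_ne hne with h | h
    · exact hPd (by omega)
    · exact (hPd (by omega)).symm
  refine mono (sup (hparity 0) (hparity 1)) fun x hx => ?_
  obtain ⟨k, hk⟩ := Opens.mem_iSup.1 hx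
  have hk0 : d k x ≠ 0 := fun h0 => by
    rw [← Metric.mem_iff_infEDist_zero_of_closed (partialSups W k).isOpen.isClosed_compl] at h0
    exact h0 (le_partialSups W k hk)
  have hex : ∃ n, 1 < e n x := by
    obtain ⟨n, hn⟩ := ENNReal.exists_nat_mul_gt hk0 ENNReal.one_ne_top
    refine ⟨max n k, hn.trans_le (mul_le_mul' ?_ (hd (le_max_right _ _) x))⟩
    exact_mod_cast le_max_left n k
  classical
  obtain ⟨m, hm⟩ : ∃ m, Nat.find hex = m + 1 := Nat.exists_eq_succ_of_ne_zero fun h => by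
    have := Nat.find_spec hex
    simp [h, e] at this
  have hxP : x ∈ P m := by
    refine ⟨hm ▸ Nat.find_spec hex, ?_⟩
    -- For `m = 0` the truncated index `m - 1` is 0, and `e 0` vanishes.
    rcases m with _ | m
    · simp [e]
    · by_contra! h
      exact Nat.find_min hex (by omega) (hstep m x h)
  rw [← SetLike.mem_coe, Opens.coe_sup, Set.mem_union, SetLike.mem_coe, SetLike.mem_coe,
    Opens.mem_iSup, Opens.mem_iSup]
  rcases m.even_or_odd' with ⟨j, rfl | rfl⟩
  · exact Or.inl ⟨⟨j⟩, hxP⟩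
  · exact Or.inr ⟨⟨j⟩, hxP⟩

end MetricSpaces

/-! ### The ℓ¹ cone and its dominant sets. -/

section Cone

/-- The cone of nonnegative summable families, with the metric of `ℓ¹`. -/
abbrev SummableCone (I : Type u) : Type u := {x : lp (fun _ : I => ℝ) 1 // ∀ i, 0 ≤ x i}

namespace SummableCone

variable {I : Type u}

/-- The sum of a nonnegative summable family. -/
noncomputable def total (x : SummableCone I) : ℝ := ‖x.1‖

theorem hasSum (x : SummableCone I) : HasSum (fun i => x.1 i) x.total := by
  have h := lp.hasSum_norm (p := 1) (by simp) x.1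
  simpa [abs_of_nonneg (x.2 _), total] using h

theorem continuous_total : Continuous (total : SummableCone I → ℝ) :=
  continuous_norm.comp continuous_subtype_val

theorem abs_apply_sub_le (x y : SummableCone I) (i : I) : |x.1 i - y.1 i| ≤ dist x y := by
  rw [Subtype.dist_eq, dist_eq_norm]
  exact lp.norm_apply_le_norm one_ne_zero (x.1 - y.1) i

theorem continuous_apply (i : I) : Continuous fun x : SummableCone I => x.1 i :=
  (lp.lipschitzWith_one_eval 1 i).continuous.comp continuous_subtype_val

/-- For comparable families the absolute values disappear, so bounds on sums control distances. -/
theorem dist_eq_of_le {x y : SummableCone I} (h : ∀ i, x.1 i ≤ y.1 i) :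
    dist x y = y.total - x.total := by
  have h1 := lp.hasSum_norm (p := 1) (by simp) (y.1 - x.1)
  simp only [ENNReal.toReal_one, Real.rpow_one, lp.coeFn_sub, Pi.sub_apply, Real.norm_eq_abs,
    abs_of_nonneg (sub_nonneg.2 (h _))] at h1
  rw [dist_comm, Subtype.dist_eq, dist_eq_norm]
  exact h1.unique (y.hasSum.sub x.hasSum)

theorem apply_le_total (x : SummableCone I) (i : I) : x.1 i ≤ x.total :=
  le_hasSum x.hasSum i fun j _ => x.2 j

instance : CompleteSpace (SummableCone I) := by
  have h : IsClosed {x : lp (fun _ : I => ℝ) 1 | ∀ i, 0 ≤ x i} := by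
    rw [Set.ofPred_forall]
    exact isClosed_iInter fun i => isClosed_le continuous_const
      (lp.lipschitzWith_one_eval 1 i).continuous
  exact h.completeSpace_coe

/-- The open set of families that are positive at `i`. -/
def posAt (i : I) : Opens (SummableCone I) :=
  ⟨{x | 0 < x.1 i}, isOpen_lt continuous_const (continuous_apply i)⟩

/-- The open set of families with positive sum. -/
def pos (I : Type u) : Opens (SummableCone I) :=
  ⟨{x | 0 < x.total}, isOpen_lt continuous_const continuous_total⟩

/-- The open set of families which are positive on `F` and for which, locally, the values on `F`
exceed all values outside `F`. -/
def dominant (F : Finset I) : Opens (SummableCone I) :=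
  ⟨interior {x | ∀ i ∈ F, 0 < x.1 i ∧ ∀ j ∉ F, x.1 j < x.1 i}, isOpen_interior⟩

theorem dominant_spec {F : Finset I} {x : SummableCone I} (hx : x ∈ dominant F) :
    ∀ i ∈ F, 0 < x.1 i ∧ ∀ j ∉ F, x.1 j < x.1 i :=
  interior_subset hx

theorem disjoint_dominant {F F' : Finset I} (hcard : F.card = F'.card) (hne : F ≠ F') :
    Disjoint (dominant F) (dominant F') := by
  rw [← Opens.coe_disjoint]
  refine Set.disjoint_left.2 fun x hx hx' => ?_
  obtain ⟨i, hi, hi'⟩ : ∃ i ∈ F, i ∉ F' := by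
    by_contra! h
    exact hne (Finset.eq_of_subset_of_card_le h hcard.ge)
  obtain ⟨j, hj', hj⟩ : ∃ j ∈ F', j ∉ F := by
    by_contra! h
    exact hne (Finset.eq_of_subset_of_card_le h hcard.le).symm
  exact ((dominant_spec hx i hi).2 j hj).asymm ((dominant_spec hx' j hj').2 i hi')

/-- Take `F` to be the superlevel set at a positive value `m` of `x`. Summability makes it finite
and leaves a gap below `m`. -/
theorem exists_mem_dominant {x : SummableCone I} (hx : x ∈ pos I) :
    ∃ F : Finset I, F.Nonempty ∧ x ∈ dominant F := by
  obtain ⟨k, hk⟩ : ∃ k, 0 < x.1 k := by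
    by_contra! h
    have h0 : (fun i => x.1 i) = fun _ => 0 := funext fun i => le_antisymm (h i) (x.2 i)
    have hs := x.hasSum
    rw [h0] at hs
    exact (show 0 < x.total from hx).ne' (hs.unique hasSum_zero)
  set m := x.1 k with hm
  have hfin : ∀ c : ℝ, 0 < c → {i | c ≤ x.1 i}.Finite := fun c hc => by
    have h := x.hasSum.summable.tendsto_cofinite_zero.eventually (gt_mem_nhds hc)
    simpa [Filter.eventually_cofinite] using h
  have hF := hfin m hk
  have hG := hfin (m / 2) (half_pos hk)
  -- Only finitely many values are at least `m / 2`, so some `M < m` exceeds every value below `m`.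
  -- Moving coordinates by less than `(m - M) / 2` keeps the two groups apart.
  obtain ⟨M, ⟨hM1, hM2⟩, hM⟩ : ∃ M, (m / 2 < M ∧ M < m) ∧
      ∀ j ∈ {j | m / 2 ≤ x.1 j}, x.1 j < m → x.1 j < M := by
    have h1 : ∀ᶠ M in nhdsWithin m (Set.Iio m), m / 2 < M ∧ M < m :=
      Filter.Eventually.and
        (Filter.Eventually.filter_mono nhdsWithin_le_nhds (lt_mem_nhds (half_lt_self hk)))
        self_mem_nhdsWithin
    have h2 : ∀ᶠ M in nhdsWithin m (Set.Iio m),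
        ∀ j ∈ {j | m / 2 ≤ x.1 j}, x.1 j < m → x.1 j < M := by
      rw [Filter.eventually_all_finite hG]
      intro j _
      by_cases hj : x.1 j < m
      · filter_upwards [Filter.Eventually.filter_mono nhdsWithin_le_nhds (lt_mem_nhds hj)]
          with M hM _ using hM
      · exact Filter.Eventually.of_forall fun M h => absurd h hj
    exact (h1.and h2).exists
  refine ⟨hF.toFinset, ⟨k, by simp [hm]⟩, ?_⟩
  refine mem_interior_iff_mem_nhds.2 (Filter.mem_of_superset
    (Metric.ball_mem_nhds x (half_pos (sub_pos.2 hM2))) fun y hy i hi => ?_)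
  have hlo : ∀ l, |y.1 l - x.1 l| < (m - M) / 2 := fun l => (abs_apply_sub_le y x l).trans_lt hy
  have hi' : m ≤ x.1 i := by simpa using hi
  have hyi := (abs_lt.1 (hlo i)).1
  refine ⟨by linarith, fun j hj => ?_⟩
  have hj' : x.1 j < m := by simpa using hj
  have hjM : x.1 j < M := by
    rcases le_or_gt (m / 2) (x.1 j) with h | h
    · exact hM j h hj'
    · exact h.trans hM1
  have hyj := (abs_lt.1 (hlo j)).2
  linarith

/-- A property of open subsets of the cone that passes to smaller open subsets, to disjoint unions
and to binary unions, and that holds for the sets of families positive at an index, holds for the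
set of families with positive sum. -/
theorem pos_induction {G : Opens (SummableCone I) → Prop}
    (mono : ∀ {U V}, G V → U ≤ V → G U)
    (disj : ∀ {K : Type u} {U : K → Opens (SummableCone I)},
      (Pairwise fun i j => Disjoint (U i) (U j)) → (∀ i, G (U i)) → G (⨆ i, U i))
    (sup : ∀ {U V}, G U → G V → G (U ⊔ V)) (base : ∀ i, G (posAt i)) : G (pos I) := by
  have hF : ∀ F : Finset I, F.Nonempty → G (dominant F) := fun F ⟨i, hi⟩ =>
    mono (base i) fun x hx => (dominant_spec hx i hi).1
  -- Cardinality starts at 1: `dominant ∅` is the whole cone.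
  have hW : ∀ n, G (⨆ F : {F : Finset I // F.card = n + 1}, dominant F.1) := fun n =>
    disj (fun F F' h => disjoint_dominant (F.2.trans F'.2.symm) fun h' => h (Subtype.ext h'))
      fun F => hF F.1 (Finset.card_pos.1 (by rw [F.2]; exact n.succ_pos))
  refine mono (iSup_nat_of_metric mono disj sup hW) fun x hx => ?_
  obtain ⟨F, hF, hxF⟩ := exists_mem_dominant hx
  exact Opens.mem_iSup.2 ⟨F.card - 1, Opens.mem_iSup.2
    ⟨⟨F, (Nat.sub_add_cancel (Finset.card_pos.2 hF)).symm⟩, hxF⟩⟩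

/-- A finitely supported family as a point of the cone. -/
def ofFinsupp (r : I →₀ ℝ≥0) : SummableCone I :=
  ⟨⟨fun i => (r i : ℝ), memℓp_gen (summable_of_ne_finset_zero (s := r.support) fun i hi => by
    simp [Finsupp.notMem_support_iff.1 hi])⟩, fun i => (r i).2⟩

theorem ofFinsupp_apply (r : I →₀ ℝ≥0) (i : I) : (ofFinsupp r).1 i = r i := rfl

theorem total_ofFinsupp (r : I →₀ ℝ≥0) : (ofFinsupp r).total = (∑ i ∈ r.support, r i : ℝ≥0) := by
  refine (ofFinsupp r).hasSum.unique ?_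
  rw [NNReal.coe_sum]
  exact hasSum_sum_of_ne_finset_zero fun i hi => by
    simp [ofFinsupp_apply, Finsupp.notMem_support_iff.1 hi]

/-- The families that strictly exceed `r` on the support of `r` and have sum less than `q`. -/
def box (r : I →₀ ℝ≥0) (q : ℝ≥0) : Set (SummableCone I) :=
  {x | (∀ i ∈ r.support, (r i : ℝ) < x.1 i) ∧ x.total < q}

theorem le_of_mem_box {r : I →₀ ℝ≥0} {q : ℝ≥0} {x : SummableCone I} (hx : x ∈ box r q) (i : I) :
    (ofFinsupp r).1 i ≤ x.1 i := by
  by_cases hi : i ∈ r.support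
  · exact (hx.1 i hi).le
  · rw [ofFinsupp_apply, Finsupp.notMem_support_iff.1 hi]
    exact x.2 i

/-- A box is small once `q` is close to the sum of its corner. -/
theorem dist_lt_of_mem_box {r : I →₀ ℝ≥0} {q : ℝ≥0} {x : SummableCone I} (hx : x ∈ box r q) :
    dist (ofFinsupp r) x < q - (∑ i ∈ r.support, r i : ℝ≥0) := by
  rw [dist_eq_of_le (le_of_mem_box hx), total_ofFinsupp]
  exact sub_lt_sub_right hx.2 _

theorem box_sup_min_subset (r r' : I →₀ ℝ≥0) (q q' : ℝ≥0) :
    box (r ⊔ r') (min q q') ⊆ box r q ∩ box r' q' := by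
  rintro x ⟨hx, hxq⟩
  rw [NNReal.coe_min, lt_min_iff] at hxq
  refine ⟨⟨fun i hi => ?_, hxq.1⟩, ⟨fun i hi => ?_, hxq.2⟩⟩
  · refine lt_of_le_of_lt ?_ (hx i (Finsupp.support_mono le_sup_left hi))
    exact NNReal.coe_le_coe.2 (le_sup_left (a := r i))
  · refine lt_of_le_of_lt ?_ (hx i (Finsupp.support_mono le_sup_right hi))
    exact NNReal.coe_le_coe.2 (le_sup_right (a := r i))

end SummableCone

end Cone

/-! ### Finite distributivity in frames. -/

section FiniteDistributivity

theorem finset_inf_iSup_le {X : Type u} [Order.Frame X] {I : Type v} {κ : Type w} [Nonempty κ]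
    (F : Finset I) (p : I → κ → Prop) (g : I → κ → X) :
    (F.inf fun i => ⨆ (k) (_ : p i k), g i k) ≤
      ⨆ (t : I → κ) (_ : ∀ i ∈ F, p i (t i)), F.inf fun i => g i (t i) := by
  classical
  induction F using Finset.induction_on with
  | empty => exact le_iSup₂_of_le (fun _ => Classical.arbitrary κ) (by simp) (by simp)
  | insert a F ha ih =>
    rw [Finset.inf_insert]
    refine (inf_le_inf_left _ ih).trans ?_
    rw [iSup₂_inf_eq]
    refine iSup₂_le fun k hk => ?_
    rw [inf_iSup₂_eq]
    refine iSup₂_le fun t ht => ?_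
    have hne : ∀ i ∈ F, Function.update t a k i = t i := fun i hi =>
      Function.update_of_ne (fun h : i = a => ha (h ▸ hi)) _ _
    refine le_iSup₂_of_le (Function.update t a k) (fun i hi => ?_) ?_
    · rcases Finset.mem_insert.1 hi with rfl | hi
      · simpa using hk
      · simpa [hne i hi] using ht i hi
    · rw [Finset.inf_insert, Function.update_self]
      exact inf_le_inf_left _ (Finset.inf_congr rfl fun i hi => by rw [hne i hi]).ge

end FiniteDistributivity

/-! ### The morphism to the cone given by a partition. -/

section ClassifyingMap

variable {X : Type u} [Order.Frame X] {I : Type u}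

/-- The open interval `[0, q)` in `[0, ∞)`. -/
def initialRay (q : ℝ≥0) : Opens ℝ≥0 := ⟨Set.Iio q, isOpen_Iio⟩

theorem map_ray_eq_iSup (f : NonnegMap X) (q : ℝ≥0) :
    f (ray q) = ⨆ (p : ℝ≥0) (_ : q < p), f (ray p) := by
  have h : ray q = ⨆ (p : ℝ≥0) (_ : q < p), ray p := by
    refine le_antisymm (fun x hx => ?_) (iSup₂_le fun p hp x hx => hp.trans hx)
    obtain ⟨p, hp, hpx⟩ := exists_between (show q < x from hx)
    exact Opens.mem_iSup.2 ⟨p, Opens.mem_iSup.2 ⟨hp, hpx⟩⟩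
  rw [h, map_iSup₂]

/-- The open part of the locale on which `f i > r i` for all `i` in the support of `r`. -/
def lowerBound (f : I → NonnegMap X) (r : I →₀ ℝ≥0) : X :=
  r.support.inf fun i => f i (ray (r i))

variable (f : I → NonnegMap X) (s : NonnegMap X)

theorem lowerBound_inf_le (r r' : I →₀ ℝ≥0) :
    lowerBound f r ⊓ lowerBound f r' ≤ lowerBound f (r ⊔ r') := by
  refine Finset.le_inf fun i hi => ?_
  rw [Finsupp.mem_support_iff, Finsupp.sup_apply] at hi
  rw [Finsupp.sup_apply]
  rcases le_total (r i) (r' i) with h | h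
  · rw [sup_eq_right.2 h] at hi ⊢
    exact inf_le_right.trans (Finset.inf_le (Finsupp.mem_support_iff.2 hi))
  · rw [sup_eq_left.2 h] at hi ⊢
    exact inf_le_left.trans (Finset.inf_le (Finsupp.mem_support_iff.2 hi))

/-- Only an inequality: indices of `F` with `r i = 0` leave the support, and their positivity
conditions are lost. -/
theorem inf_le_lowerBound_indicator (F : Finset I) (r : I → ℝ≥0) :
    (F.inf fun i => f i (ray (r i))) ≤ lowerBound f (Finsupp.indicator F fun i _ => r i) := by
  classical
  refine Finset.le_inf fun i hi => ?_
  have hiF := Finsupp.support_indicator_subset F _ hi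
  rw [Finsupp.indicator_of_mem hiF]
  exact Finset.inf_le hiF

theorem sum_indicator (F : Finset I) (r : I → ℝ≥0) :
    ∑ i ∈ (Finsupp.indicator F fun i _ => r i).support, (Finsupp.indicator F fun i _ => r i) i =
      ∑ i ∈ F, r i := by
  classical
  rw [Finset.sum_subset (Finsupp.support_indicator_subset F _)
    fun i _ hi => Finsupp.notMem_support_iff.1 hi]
  exact Finset.sum_congr rfl fun i hi => Finsupp.indicator_of_mem hi _

theorem lowerBound_le_iSup (r : I →₀ ℝ≥0) :
    lowerBound f r ≤ ⨆ (t : I →₀ ℝ≥0) (_ : ∀ i ∈ r.support, r i < t i), lowerBound f t := by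
  classical
  have h : lowerBound f r =
      r.support.inf fun i => ⨆ (p : ℝ≥0) (_ : r i < p), f i (ray p) :=
    Finset.inf_congr rfl fun i _ => map_ray_eq_iSup (f i) (r i)
  rw [h]
  refine (finset_inf_iSup_le _ (fun i p => r i < p) fun i p => f i (ray p)).trans ?_
  refine iSup₂_le fun t ht => le_iSup₂_of_le (Finsupp.indicator r.support fun i _ => t i)
    (fun i hi => ?_) (inf_le_lowerBound_indicator f _ _)
  rw [Finsupp.indicator_of_mem hi]
  exact ht i hi

variable {f s}

theorem IsSum.lowerBound_le (hs : IsSum f s) {r : I →₀ ℝ≥0} {q : ℝ≥0}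
    (h : q < ∑ i ∈ r.support, r i) : lowerBound f r ≤ s (ray q) := by
  rw [hs q, lowerBound, Finset.inf_eq_iInf]
  exact le_iSup_of_le r.support (le_iSup_of_le r (le_iSup_of_le h le_rfl))

theorem IsSum.map_ray_le (hs : IsSum f s) (q : ℝ≥0) :
    s (ray q) ≤ ⨆ (r : I →₀ ℝ≥0) (_ : q < ∑ i ∈ r.support, r i), lowerBound f r := by
  rw [hs q]
  refine iSup_le fun F => iSup_le fun r => iSup_le fun h => ?_
  refine le_iSup₂_of_le (Finsupp.indicator F fun i _ => r i) (by rwa [sum_indicator]) ?_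
  rw [← Finset.inf_eq_iInf]
  exact inf_le_lowerBound_indicator f F r

variable (f s)

/-- The open part of the locale on which `f` lies in `SummableCone.box r q`, where `s` is the sum
of `f`. -/
def boxOpen (r : I →₀ ℝ≥0) (q : ℝ≥0) : X := lowerBound f r ⊓ s (initialRay q)

theorem boxOpen_inf_le (r r' : I →₀ ℝ≥0) (q q' : ℝ≥0) :
    boxOpen f s r q ⊓ boxOpen f s r' q' ≤ boxOpen f s (r ⊔ r') (min q q') := by
  rw [boxOpen, boxOpen, inf_inf_inf_comm, ← map_inf]
  exact inf_le_inf (lowerBound_inf_le f r r')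
    (OrderHomClass.mono s fun x hx => show x < min q q' from lt_min hx.1 hx.2)

variable {f s}

theorem IsSum.sum_le_of_boxOpen_ne_bot (hs : IsSum f s) {r : I →₀ ℝ≥0} {q : ℝ≥0}
    (h : boxOpen f s r q ≠ ⊥) : ∑ i ∈ r.support, r i ≤ q := by
  by_contra! hq
  refine h (le_bot_iff.1 ((inf_le_inf_right _ (hs.lowerBound_le hq)).trans ?_))
  rw [← map_inf, ← map_bot s]
  exact OrderHomClass.mono s fun x hx => (lt_asymm (show q < x from hx.1) hx.2).elim

/-- The box is covered by the smaller ones described here, so if all of these were below `c`, it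
would be too. -/
theorem IsSum.exists_refinement (hs : IsSum f s) {r : I →₀ ℝ≥0} {q : ℝ≥0} {c : X}
    (h : ¬ boxOpen f s r q ≤ c) {ε : ℝ≥0} (hε : 0 < ε) :
    ∃ (t : I →₀ ℝ≥0) (q' : ℝ≥0), (∀ i ∈ r.support, r i < t i) ∧ q' < q ∧
      q' < ∑ i ∈ t.support, t i + ε ∧ ¬ boxOpen f s t q' ≤ c := by
  contrapose! h
  let D : ℝ≥0 → Opens ℝ≥0 := fun q' =>
    ⟨{y : ℝ≥0 | y < q' ∧ q' < y + ε}, (isOpen_lt continuous_id continuous_const).inter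
      (isOpen_lt continuous_const (by fun_prop))⟩
  have hD : initialRay q = ⨆ (q' : ℝ≥0) (_ : q' < q), D q' := by
    refine le_antisymm (fun y hy => ?_) (iSup₂_le fun q' hq' y hy => hy.1.trans hq')
    obtain ⟨q', h1, h2⟩ := exists_between (lt_min hy (lt_add_of_pos_right y hε))
    exact Opens.mem_iSup.2 ⟨q', Opens.mem_iSup.2
      ⟨h2.trans_le (min_le_left _ _), h1, h2.trans_le (min_le_right _ _)⟩⟩
  rw [boxOpen, hD, map_iSup₂, inf_iSup₂_eq]
  refine iSup₂_le fun q' hq' => ?_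
  refine (inf_le_inf_right _ (lowerBound_le_iSup f r)).trans ?_
  rw [iSup₂_inf_eq]
  refine iSup₂_le fun t ht => ?_
  have hDle : s (D q') ≤ s (initialRay q') := OrderHomClass.mono s fun y hy => hy.1
  -- If `q' < ε`, the sum condition is automatic. Otherwise `s > q' - ε` yields lower bounds `r'`
  -- with large sum, which are joined to `t`.
  rcases lt_or_ge q' ε with hqε | hqε
  · exact (inf_le_inf_left _ hDle).trans (h t q' ht hq' (hqε.trans_le le_add_self))
  · have hray : s (D q') ≤ s (ray (q' - ε)) := OrderHomClass.mono s fun y hy =>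
      show q' - ε < y from (tsub_lt_iff_right hqε).2 hy.2
    refine (inf_le_inf_left _ (le_inf (hray.trans (hs.map_ray_le _)) hDle)).trans ?_
    rw [iSup₂_inf_eq, inf_iSup₂_eq]
    refine iSup₂_le fun r' hr' => ?_
    rw [← inf_assoc]
    refine (inf_le_inf_right _ (lowerBound_inf_le f t r')).trans
      (h (t ⊔ r') q' (fun i hi => (ht i hi).trans_le le_sup_left) hq' ?_)
    rw [tsub_lt_iff_right hqε] at hr'
    refine hr'.trans_le (add_le_add_left ?_ _)
    exact (Finset.sum_le_sum_of_subset (Finsupp.support_mono le_sup_right)).trans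
      (Finset.sum_le_sum fun i _ => le_sup_right)

/-- This replaces pointwise reasoning: an inequality in `X` may be tested at points of the cone,
using small boxes around each. -/
theorem IsSum.boxOpen_le (hs : IsSum f s) {r : I →₀ ℝ≥0} {q : ℝ≥0} {c : X}
    (h : ∀ x ∈ SummableCone.box r q, ∃ ε : ℝ≥0, 0 < ε ∧ ∀ (t : I →₀ ℝ≥0) (q' : ℝ≥0),
      x ∈ SummableCone.box t q' → q' < ∑ i ∈ t.support, t i + ε → boxOpen f s t q' ≤ c) :
    boxOpen f s r q ≤ c := by
  by_contra hc
  let P := {b : (I →₀ ℝ≥0) × ℝ≥0 // ¬ boxOpen f s b.1 b.2 ≤ c}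
  have hstep : ∀ (n : ℕ) (b : P), ∃ b' : P, (∀ i ∈ b.1.1.support, b.1.1 i < b'.1.1 i) ∧
      b'.1.2 < b.1.2 ∧ b'.1.2 < ∑ i ∈ b'.1.1.support, b'.1.1 i + 1 / ((n : ℝ≥0) + 1) :=
    fun n b => by
      obtain ⟨t, q', h1, h2, h3, h4⟩ :=
        hs.exists_refinement b.2 (ε := 1 / ((n : ℝ≥0) + 1)) (by positivity)
      exact ⟨⟨(t, q'), h4⟩, h1, h2, h3⟩
  choose next hnext using hstep
  let b : ℕ → P := fun n => Nat.rec ⟨(r, q), hc⟩ next n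
  have hlt : ∀ n, ∀ i ∈ (b n).1.1.support, (b n).1.1 i < (b (n + 1)).1.1 i :=
    fun n => (hnext n (b n)).1
  have hqlt : ∀ n, (b (n + 1)).1.2 < (b n).1.2 := fun n => (hnext n (b n)).2.1
  have hsmall : ∀ n : ℕ, (b (n + 1)).1.2 <
      ∑ i ∈ (b (n + 1)).1.1.support, (b (n + 1)).1.1 i + 1 / ((n : ℝ≥0) + 1) :=
    fun n => (hnext n (b n)).2.2
  have hle : ∀ n, ∑ i ∈ (b n).1.1.support, (b n).1.1 i ≤ (b n).1.2 := fun n =>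
    hs.sum_le_of_boxOpen_ne_bot fun h0 => (b n).2 (h0 ▸ bot_le)
  have hmono : Monotone fun n => (b n).1.1 := monotone_nat_of_le_succ fun n i => by
    by_cases hi : i ∈ (b n).1.1.support
    · exact (hlt n i hi).le
    · rw [Finsupp.notMem_support_iff.1 hi]
      exact zero_le
  have hanti : Antitone fun n => (b n).1.2 := antitone_nat_of_succ_le fun n => (hqlt n).le
  let y : ℕ → SummableCone I := fun n => SummableCone.ofFinsupp (b n).1.1
  have hytot : ∀ n, (y n).total ≤ (b n).1.2 := fun n => by
    rw [SummableCone.total_ofFinsupp]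
    exact_mod_cast hle n
  -- The shift by one is needed because the initial box carries no smallness bound.
  have hcauchy : CauchySeq fun n => y (n + 1) := by
    refine cauchySeq_of_le_tendsto_0' (fun n : ℕ => 1 / ((n : ℝ) + 1)) (fun n m hnm => ?_)
      tendsto_one_div_add_atTop_nhds_zero_nat
    rw [SummableCone.dist_eq_of_le fun i => by exact_mod_cast hmono (Nat.succ_le_succ hnm) i]
    have h1 : ((b (n + 1)).1.2 : ℝ) < (y (n + 1)).total + 1 / ((n : ℝ) + 1) := by
      rw [SummableCone.total_ofFinsupp]
      exact_mod_cast hsmall n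
    have h2 : ((b (m + 1)).1.2 : ℝ) ≤ (b (n + 1)).1.2 := by
      exact_mod_cast hanti (Nat.succ_le_succ hnm)
    have h3 := hytot (m + 1)
    linarith
  obtain ⟨x, hx'⟩ := cauchySeq_tendsto_of_complete hcauchy
  have hx : Filter.Tendsto y Filter.atTop (nhds x) := (Filter.tendsto_add_atTop_iff_nat 1).1 hx'
  have hyx : ∀ n i, ((b n).1.1 i : ℝ) ≤ x.1 i := fun n i =>
    ge_of_tendsto (((SummableCone.continuous_apply i).tendsto x).comp hx)
      (Filter.eventually_atTop.2 ⟨n, fun m hm => by exact_mod_cast hmono hm i⟩)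
  have hxq : ∀ n, x.total ≤ (b n).1.2 := fun n =>
    le_of_tendsto ((SummableCone.continuous_total.tendsto x).comp hx)
      (Filter.eventually_atTop.2 ⟨n, fun m hm => (hytot m).trans (by exact_mod_cast hanti hm)⟩)
  -- The limit satisfies only weak inequalities; strict improvement at the next stage makes them
  -- strict.
  have hbox : ∀ n, x ∈ SummableCone.box (b n).1.1 (b n).1.2 := fun n =>
    ⟨fun i hi => (NNReal.coe_lt_coe.2 (hlt n i hi)).trans_le (hyx (n + 1) i),
      (hxq (n + 1)).trans_lt (NNReal.coe_lt_coe.2 (hqlt n))⟩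
  obtain ⟨ε, hε, H⟩ := h x (hbox 0)
  obtain ⟨n, hn⟩ := exists_nat_one_div_lt hε
  exact (b (n + 1)).2 (H _ _ (hbox (n + 1)) ((hsmall n).trans (add_lt_add_right hn _)))

/-- A family of nonnegative functions with a continuous sum is a morphism to the space of
nonnegative summable families. -/
def IsSum.hom (hs : IsSum f s) : FrameHom (Opens (SummableCone I)) X where
  toFun O := ⨆ (b : (I →₀ ℝ≥0) × ℝ≥0) (_ : SummableCone.box b.1 b.2 ⊆ O), boxOpen f s b.1 b.2
  map_top' := by
    refine top_unique ?_
    have h : (⊤ : Opens ℝ≥0) = ⨆ q, initialRay q :=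
      (top_unique fun y _ => Opens.mem_iSup.2 (exists_gt y)).symm
    rw [← map_top s, h, map_iSup]
    refine iSup_le fun q => le_iSup₂_of_le (0, q) (Set.subset_univ _) ?_
    simp [boxOpen, lowerBound]
  map_inf' O O' := by
    refine le_antisymm (iSup₂_le fun b hb => le_inf ?_ ?_) ?_
    · exact le_iSup₂_of_le b (hb.trans Set.inter_subset_left) le_rfl
    · exact le_iSup₂_of_le b (hb.trans Set.inter_subset_right) le_rfl
    · rw [iSup₂_inf_eq]
      refine iSup₂_le fun b hb => ?_
      rw [inf_iSup₂_eq]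
      refine iSup₂_le fun b' hb' => le_iSup₂_of_le (b.1 ⊔ b'.1, min b.2 b'.2) ?_
        (boxOpen_inf_le f s _ _ _ _)
      exact (SummableCone.box_sup_min_subset _ _ _ _).trans (Set.inter_subset_inter hb hb')
  map_sSup' S := by
    apply le_antisymm
    · refine iSup₂_le fun b hb => hs.boxOpen_le fun x hx => ?_
      obtain ⟨O, hO, hxO⟩ := Opens.mem_sSup.1 (hb hx)
      obtain ⟨δ, hδ, hball⟩ := Metric.isOpen_iff.1 O.isOpen x hxO
      -- All points of such a box, including `x`, are within `δ / 2` of its corner, so the box lies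
      -- in the `δ`-ball.
      refine ⟨(δ / 2).toNNReal, Real.toNNReal_pos.2 (half_pos hδ), fun t q' hxt hq' => ?_⟩
      refine le_sSup_of_le ⟨O, hO, rfl⟩ (le_iSup₂_of_le (t, q') (fun y hy => hball ?_) le_rfl)
      have h1 := SummableCone.dist_lt_of_mem_box hxt
      have h2 := SummableCone.dist_lt_of_mem_box hy
      have h3 : (q' : ℝ) < (∑ i ∈ t.support, t i : ℝ≥0) + δ / 2 := by
        rw [← Real.coe_toNNReal (δ / 2) (half_pos hδ).le]
        exact_mod_cast hq'
      have h4 := dist_triangle_left y x (SummableCone.ofFinsupp t)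
      rw [Metric.mem_ball]
      linarith
    · refine sSup_le ?_
      rintro _ ⟨O, hO, rfl⟩
      exact iSup₂_le fun b hb => le_iSup₂_of_le b
        (hb.trans fun x hx => Opens.mem_sSup.2 ⟨O, hO, hx⟩) le_rfl

theorem IsSum.hom_posAt_le (hs : IsSum f s) (i : I) :
    hs.hom (SummableCone.posAt i) ≤ f i (ray 0) := by
  refine iSup₂_le fun b hb => hs.boxOpen_le fun x hx => ?_
  have hxi : 0 < x.1 i := hb hx
  refine ⟨(x.1 i).toNNReal, Real.toNNReal_pos.2 hxi, fun t q' hxt hq' => ?_⟩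
  -- Otherwise the corner vanishes at `i` and is at distance at least `x.1 i` from `x`.
  have hi : i ∈ t.support := by
    by_contra hi
    have h1 := (SummableCone.abs_apply_sub_le _ x i).trans_lt
      (SummableCone.dist_lt_of_mem_box hxt)
    rw [SummableCone.ofFinsupp_apply, Finsupp.notMem_support_iff.1 hi, NNReal.coe_zero, zero_sub,
      abs_neg, abs_of_pos hxi] at h1
    have h2 : (q' : ℝ) < (∑ i ∈ t.support, t i : ℝ≥0) + x.1 i := by
      rw [← Real.coe_toNNReal (x.1 i) hxi.le]
      exact_mod_cast hq'
    linarith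
  exact inf_le_left.trans ((Finset.inf_le hi).trans
    (OrderHomClass.mono (f i) fun y hy => (zero_le (a := t i)).trans_lt hy))

theorem IsSum.hom_pos (hs : IsSum f s) (h : s (ray 0) = ⊤) :
    hs.hom (SummableCone.pos I) = ⊤ := by
  have htop : (⊤ : X) ≤ ⨆ q, s (initialRay q) := by
    rw [← map_iSup, ← map_top s]
    exact OrderHomClass.mono s fun y _ => Opens.mem_iSup.2 (exists_gt y)
  refine top_unique ((le_inf (h.ge.trans (hs.map_ray_le 0)) htop).trans ?_)
  rw [iSup₂_inf_eq]
  refine iSup₂_le fun r hr => ?_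
  rw [inf_iSup_eq]
  refine iSup_le fun q => le_iSup₂_of_le (r, q) (fun x hx => ?_) le_rfl
  obtain ⟨i, hi, -⟩ := Finset.exists_ne_zero_of_sum_ne_zero hr.ne'
  exact (NNReal.coe_nonneg _).trans_lt ((hx.1 i hi).trans_le (x.apply_le_total i))

end ClassifyingMap

/-! ### Comparison of the topologies. -/

section Comparison

variable {J : GrothendieckTopology Locale.{u}}

theorem generate_openFamily_mem_of_isNumerable
    (hdisj : ∀ (Y : Locale.{u}) (I : Type u) (U : I → Y), IsDisjointCover U →
      Sieve.generate (openFamily Y U) ∈ J Y)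
    (hpair : ∀ (Y : Locale.{u}) (U : Fin 2 → Y), IsNumerable U →
      Sieve.generate (openFamily Y U) ∈ J Y)
    (X : Locale.{u}) (I : Type u) (U : I → X) (hU : IsNumerable U) :
    Sieve.generate (openFamily X U) ∈ J X := by
  obtain ⟨-, f, ⟨s, hs, hpos⟩, hf⟩ := hU
  let T : Locale.{u} := Locale.of (Opens (SummableCone I))
  let S : Sieve T := Sieve.generate (openFamily T SummableCone.posAt)
  have hS : CoversOver J S (SummableCone.pos I) :=
    SummableCone.pos_induction (G := fun O => CoversOver J S O) (fun hV h => hV.mono h)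
      (fun hd hG => coversOver_iSup_of_disjoint hdisj hd hG) (coversOver_sup hpair)
      (coversOver_generate_openFamily _)
  let g : X ⟶ T := Quiver.Hom.op (Frm.ofHom hs.hom)
  refine J.superset_covering (fun Y k hk => ?_) (hS g (hs.hom_pos hpos))
  obtain ⟨i, hi⟩ := (generate_openFamily_iff _ _).1 hk
  exact (generate_openFamily_iff U k).2 ⟨i, top_unique (hi.ge.trans
    (OrderHomClass.mono (inverseImage k) ((hs.hom_posAt_le i).trans (hf i))))⟩

theorem openFamily_comp_equiv (X : Locale.{u}) {I : Type v} {K : Type w} (U : I → X) (e : K ≃ I) :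
    openFamily X (U ∘ e) = openFamily X U := by
  apply le_antisymm
  · rintro _ _ ⟨k⟩
    exact ⟨e k⟩
  · rintro _ _ ⟨i⟩
    obtain ⟨k, rfl⟩ := e.surjective i
    exact Presieve.ofArrows.mk (Y := fun k => openSublocale X (U (e k))) k

end Comparison

end LocaleNumerable

theorem mainTheorem11 :
    LocaleNumerable.numerableCoverage.{u}.toGrothendieck =
      (LocaleNumerable.disjointCovers.{u} ⊔
        LocaleNumerable.twoElementNumerableCovers.{u}).toGrothendieck := by
  rw [← Coverage.toGrothendieck_toPrecoverage]
  apply le_antisymm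
  · rw [Precoverage.toGrothendieck_le_iff_le_toPrecoverage]
    rintro X _ ⟨I, U, hU, rfl⟩
    exact LocaleNumerable.generate_openFamily_mem_of_isNumerable
      (fun Y I U hU => Precoverage.toGrothendieck_mono le_sup_left Y
        (Precoverage.generate_mem_toGrothendieck (J := LocaleNumerable.disjointCovers)
          ⟨I, U, hU, rfl⟩))
      (fun Y U hU => Precoverage.toGrothendieck_mono le_sup_right Y
        (Precoverage.generate_mem_toGrothendieck (J := LocaleNumerable.twoElementNumerableCovers)
          ⟨U, hU, rfl⟩)) X I U hU
  · refine Precoverage.toGrothendieck_mono (sup_le ?_ ?_)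
    · rintro X _ ⟨I, U, hU, rfl⟩
      exact ⟨I, U, hU.isNumerable, rfl⟩
    · rintro X _ ⟨U, hU, rfl⟩
      -- The numerable coverage takes its index types in universe `u`.
      exact ⟨ULift (Fin 2), U ∘ Equiv.ulift, hU.reindex Equiv.ulift,
        (LocaleNumerable.openFamily_comp_equiv X U Equiv.ulift).symm⟩
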